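/- Consider an electrical power network whose graph is a tree with vertex set (buses) $\mathcal V=\{1,\dots,n\}$ and edge set (lines) $\mathcal E$. Let the line between buses $i$ and $k$ have admittance $g_{ik}-\mathrm{j}\,b_{ik}$ with $g_{ik}=g_{ki}\ge 0$ and $b_{ik}=b_{ki}\ge 0$, let the voltage magnitudes $\overline V_i\ge 0$ be fixed, and let the angle difference $\theta_{ik}=\theta_i-\theta_k=-\theta_{ki}$ across each line be restricted to an interval $[\underline\theta_{ik},\overline\theta_{ik}]$ with $\underline\theta_{ik}\in[-\pi,0]$, $\overline\theta_{ik}\in[0,\pi]$ (so $\overline\theta_{ki}=-\underline\theta_{ik}$). The flow on the line $(i,k)$ at angle difference $\theta$ is the pair $$P_{ik}=\overline V_i^2 g_{ik}+\overline V_i\overline V_k b_{ik}\sin\theta-\overline V_i\overline V_k g_{ik}\cos\theta,\qquad P_{ki}=\overline V_k^2 g_{ik}-\overline V_i\overline V_k b_{ik}\sin\theta-\overline V_i\overline V_k g_{ik}\cos\theta .$$ Let $\mathcal F_{\theta_{ik}}\subset\mathbb R^2$ be the set of pairs $(P_{ik},P_{ki})$ obtained as $\theta$ ranges over $[\underline\theta_{ik},\overline\theta_{ik}]$,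 let $\mathcal F_\theta=\prod_{(i,k)\in\mathcal E}\mathcal F_{\theta_{ik}}$, and let $\mathcal P_\theta\subset\mathbb R^n$ be the image of $\mathcal F_\theta$ under the linear map that sends a flow vector to the vector of bus injections $P_i=\sum_{k\sim i}P_{ik}$. Given $\underline{\mathbf p},\overline{\mathbf p}\in\mathbb R^n$, let $\mathcal P_P=\{\mathbf p\in\mathbb R^n:\underline{\mathbf p}\le\mathbf p\le\overline{\mathbf p}\}$ (componentwise) and $\mathcal P=\mathcal P_\theta\cap\mathcal P_P$. For $\mathcal A\subseteq\mathbb R^n$ let $\mathcal O(\mathcal A)$ denote its Pareto front, i.e. the set of all $\mathbf x\in\mathcal A$ for which there is no $\mathbf y\in\mathcal A$ with $\mathbf y\le\mathbf x$ componentwise and strict inequality in at least one coordinate. Suppose that $\mathcal P\neq\emptyset$ and that $$-\tan^{-1}\!\Big(\frac{b_{ik}}{g_{ik}}\Big)<\underline\theta_{ik}\le\overline\theta_{ik}<\tan^{-1}\!\Big(\frac{b_{ik}}{g_{ik}}\Big)\qquad\text{for all }(i,k)\in\mathcal E,$$ where $\tan^{-1}(b_{ik}/g_{ik})$ is read as $\pi/2$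 if $g_{ik}=0$. Then $$\mathcal O(\mathcal P)=\mathcal O\big(\operatorname{conv}(\mathcal P_\theta)\cap\mathcal P_P\big).$$ -/

import Mathlib

/-- The Pareto front of a set `A` of real vectors: the points of `A` for which no other point of
`A` is componentwise smaller or equal, with strict inequality in at least one coordinate. -/
def paretoFront {ι : Type*} (A : Set (ι → ℝ)) : Set (ι → ℝ) :=
  {x | x ∈ A ∧ ¬ ∃ y ∈ A, y ≤ x ∧ ∃ i, y i < x i}

/-- A tree power network on the buses `0, …, n - 1` with fixed voltage magnitudes and an angle
interval for every line. Line data are indexed by ordered pairs of buses and are only relevant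
(and only constrained) on pairs of adjacent buses; they describe one physical line per edge,
whence the symmetry conditions. -/
structure TreeNetwork (n : ℕ) where
  /-- `graph.Adj i k` means that there is a line between the buses `i` and `k`. -/
  graph : SimpleGraph (Fin n)
  isTree : graph.IsTree
  /-- The admittance of the line between `i` and `k` is `g i k - j * b i k`. -/
  g : Fin n → Fin n → ℝ
  b : Fin n → Fin n → ℝ
  g_symm : ∀ i k, graph.Adj i k → g k i = g i k
  b_symm : ∀ i k, graph.Adj i k → b k i = b i k
  g_nonneg : ∀ i k, graph.Adj i k → 0 ≤ g i k
  b_nonneg : ∀ i k, graph.Adj i k → 0 ≤ b i k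
  /-- The fixed voltage magnitudes. -/
  V : Fin n → ℝ
  V_nonneg : ∀ i, 0 ≤ V i
  /-- The angle difference `θ_i - θ_k` is restricted to `[θmin i k, θmax i k]`. -/
  θmin : Fin n → Fin n → ℝ
  θmax : Fin n → Fin n → ℝ
  θmin_mem : ∀ i k, graph.Adj i k → θmin i k ∈ Set.Icc (-Real.pi) 0
  θmax_mem : ∀ i k, graph.Adj i k → θmax i k ∈ Set.Icc 0 Real.pi
  /-- The constraint on `θ_k - θ_i` is the constraint on `θ_i - θ_k`, read from the other end. -/
  θmax_swap : ∀ i k, graph.Adj i k → θmax k i = -θmin i k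

namespace TreeNetwork

variable {n : ℕ}

/-- The active power `P_ik` flowing from bus `i` to bus `k` at angle difference
`θ = θ_i - θ_k`. -/
noncomputable def flow (N : TreeNetwork n) (i k : Fin n) (θ : ℝ) : ℝ :=
  N.V i ^ 2 * N.g i k + N.V i * N.V k * N.b i k * Real.sin θ
    - N.V i * N.V k * N.g i k * Real.cos θ

/-- The angle-constrained flow region of the line `(i, k)`: the pairs `(P_ik, P_ki)` obtained
when `θ_i - θ_k` ranges over its interval. -/
def lineFlowRegion (N : TreeNetwork n) (i k : Fin n) : Set (ℝ × ℝ) :=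
  {q | ∃ θ ∈ Set.Icc (N.θmin i k) (N.θmax i k), q = (N.flow i k θ, N.flow k i (-θ))}

/-- The flow region: the product of the flow regions of the lines. A flow vector has one entry
for each line and each of its two directions. -/
def flowRegion (N : TreeNetwork n) : Set (N.graph.Dart → ℝ) :=
  {f | ∀ d : N.graph.Dart, (f d, f d.symm) ∈ N.lineFlowRegion d.fst d.snd}

/-- The matrix taking the flow vector to the vector of bus injections
`P_i = ∑ k ∼ i, P_ik`. -/
def injectionMatrix (N : TreeNetwork n) : Matrix (Fin n) N.graph.Dart ℝ :=
  Matrix.of fun i d => if i = d.fst then 1 else 0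

open Classical in
/-- The angle-constrained injection region `P_θ`. -/
noncomputable def angleInjectionRegion (N : TreeNetwork n) : Set (Fin n → ℝ) :=
  (fun f => N.injectionMatrix.mulVec f) '' N.flowRegion

/-- The hyper-rectangle `P_P` of the bus power constraints. -/
def powerBox (pmin pmax : Fin n → ℝ) : Set (Fin n → ℝ) :=
  {p | pmin ≤ p ∧ p ≤ pmax}

/-- The injection region `P = P_θ ∩ P_P`. -/
noncomputable def injectionRegion (N : TreeNetwork n) (pmin pmax : Fin n → ℝ) :
    Set (Fin n → ℝ) :=
  N.angleInjectionRegion ∩ powerBox pmin pmax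

/-- The angle `arctan (b / g)` of a line, understood as `π / 2` for a lossless line (`g = 0`). -/
noncomputable def criticalAngle (N : TreeNetwork n) (i k : Fin n) : ℝ :=
  if N.g i k = 0 then Real.pi / 2 else Real.arctan (N.b i k / N.g i k)

/-- The angle assumption. -/
def AngleAssumption (N : TreeNetwork n) : Prop :=
  ∀ i k, N.graph.Adj i k →
    -N.criticalAngle i k < N.θmin i k ∧ N.θmin i k ≤ N.θmax i k ∧
      N.θmax i k < N.criticalAngle i k

end TreeNetwork

/-! The relaxed set contains the injection region, so the fronts agree once every relaxed point `x`
has a point of the injection region below it (`paretoFront_eq_of_forall_exists_le`).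

On each line, replacing a chord point of the flow curve by the curve point with the same averaged
sine lowers both flows. Hence some angle vector `a` has injections at most `x`
(`convexHull_angleInjectionRegion_subset`). These may violate `pmin`, but a feasible point supplies
angles `b` with injections at least `pmin`.

The angle bounds make one flow of each line nondecreasing in the angle and the other nonincreasing.
On a tree this gives an intermediate value argument: leaves are eliminated one by one, each passing
to its parent an interval of attainable flows. The result is a single angle vector with injections
in `[pmin, x]` (`exists_add_forestOutput_mem_Icc`). -/

/-! ### Rooting a tree -/

theorem SimpleGraph.IsTree.exists_parent {V : Type*} {G : SimpleGraph V} (hG : G.IsTree) :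
    ∃ (par : V → Option V) (rank : V → ℕ),
      (∀ v w, par v = some w → rank w < rank v) ∧
      ∀ v w, G.Adj v w ↔ par v = some w ∨ par w = some v := by
  classical
  obtain ⟨r⟩ := hG.connected.nonempty
  have huniq : ∀ v w x, G.Adj v w → G.Adj v x → G.dist r w < G.dist r v →
      G.dist r x < G.dist r v → w = x := by
    -- A shortest path to `w` avoids the farther vertex `v`, so appending `v` gives the unique path
    -- from `r` to `v`.
    have key : ∀ v w (_ : G.Adj v w) (_ : G.dist r w < G.dist r v) (q : G.Walk r v),
        q.IsPath → w = q.penultimate := by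
      intro v w hvw hw q hq
      obtain ⟨p, hp, hpl⟩ := hG.connected.exists_path_of_dist r w
      have hv : v ∉ p.support := fun h => by
        have h1 := SimpleGraph.dist_le (p.takeUntil v h)
        have h2 := p.length_takeUntil_le_length h
        omega
      have := (hG.existsUnique_path r v).unique hq (hp.concat hv hvw.symm)
      rw [this]
      simp
    intro v w x hw hx hdw hdx
    obtain ⟨q, hq, -⟩ := hG.existsUnique_path r v
    rw [key v w hw hdw q hq, key v x hx hdx q hq]
  refine ⟨fun v => if h : ∃ w, G.Adj v w ∧ G.dist r w < G.dist r v then some h.choose else none,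
    fun v => G.dist r v, ?_, ?_⟩
  · intro v w h
    dsimp only at h
    split_ifs at h with hv
    rw [← Option.some_inj.1 h]
    exact hv.choose_spec.2
  have hpar : ∀ v w, (if h : ∃ w, G.Adj v w ∧ G.dist r w < G.dist r v then
      some h.choose else none) = some w ↔ G.Adj v w ∧ G.dist r w < G.dist r v := by
    intro v w
    constructor
    · intro h
      split_ifs at h with hv
      rw [← Option.some_inj.1 h]
      exact hv.choose_spec
    · intro h
      have hv : ∃ w, G.Adj v w ∧ G.dist r w < G.dist r v := ⟨w, h⟩
      rw [dif_pos hv, huniq v w _ h.1 hv.choose_spec.1 h.2 hv.choose_spec.2]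
  intro v w
  simp only [hpar]
  constructor
  · intro h
    rcases (hG.dist_ne_of_adj r h).lt_or_gt with h' | h'
    · exact Or.inr ⟨h.symm, h'⟩
    · exact Or.inl ⟨h, h'⟩
  · rintro (h | h)
    exacts [h.1, h.1.symm]

/-! ### Leaf elimination for monotone flows on a forest -/

/-- The net output of the vertex `v` of a forest with parent map `par`, when the children in `s`
are taken into account and the edge from `c` to its parent carries the parameter `t c`: it
contributes `up c (t c)` to `c` and `down c (t c)` to the parent. -/
def forestOutput {ι : Type*} [DecidableEq ι] (par : ι → Option ι) (up down : ι → ℝ → ℝ)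
    (s : Finset ι) (t : ι → ℝ) (v : ι) : ℝ :=
  up v (t v) + ∑ c ∈ s, if par c = some v then down c (t c) else 0

/-- For an increasing continuous `f`, if `α + f a ≤ x` and `p ≤ β + f b`, then values in `[p, x]`
are attained at a parameter above `a` and at a parameter below `b`. -/
theorem exists_mem_Icc_of_monotoneOn {T S : Set ℝ} (hT : Convex ℝ T) (hS : Convex ℝ S)
    {f : ℝ → ℝ} (hf : ContinuousOn f T) {p x α β a b : ℝ} (hpx : p ≤ x)
    (hα : α ∈ S) (hβ : β ∈ S) (ha : a ∈ T) (hb : b ∈ T) (hmono : MonotoneOn f T)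
    (h₁ : α + f a ≤ x) (h₂ : p ≤ β + f b) :
    (∃ c ∈ T, a ≤ c ∧ ∃ σ ∈ S, p ≤ σ + f c ∧ σ + f c ≤ x) ∧
      ∃ c ∈ T, c ≤ b ∧ ∃ σ ∈ S, p ≤ σ + f c ∧ σ + f c ≤ x := by
  have hTo := hT.ordConnected
  have hSo := hS.ordConnected
  have ivt : ∀ y, f a ≤ y → y ≤ f b → a ≤ b → ∃ c ∈ T, a ≤ c ∧ c ≤ b ∧ f c = y := by
    intro y h1 h2 hab
    obtain ⟨c, hc, rfl⟩ :=
      intermediate_value_Icc hab (hf.mono (hTo.out ha hb)) ⟨h1, h2⟩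
    exact ⟨c, hTo.out ha hb hc, hc.1, hc.2, rfl⟩
  have hab : f a < f b → a ≤ b := fun h => by
    by_contra! h'
    exact absurd (hmono hb ha h'.le) (not_le.2 h)
  constructor
  -- Raise the slack from `α` towards `β` first; only if `β` is still too small, raise the
  -- parameter. The other half is the mirror image.
  · by_cases h : p ≤ α + f a
    · exact ⟨a, ha, le_rfl, α, hα, h, h₁⟩
    by_cases h' : p ≤ β + f a
    · exact ⟨a, ha, le_rfl, p - f a, hSo.out hα hβ ⟨by linarith, by linarith⟩,
        by linarith, by linarith⟩
    obtain ⟨c, hc, hac, -, hfc⟩ := ivt (p - β) (by linarith) (by linarith) (hab (by linarith))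
    exact ⟨c, hc, hac, β, hβ, by linarith, by linarith⟩
  · by_cases h : β + f b ≤ x
    · exact ⟨b, hb, le_rfl, β, hβ, h₂, h⟩
    by_cases h' : α + f b ≤ x
    · exact ⟨b, hb, le_rfl, x - f b, hSo.out hα hβ ⟨by linarith, by linarith⟩,
        by linarith, by linarith⟩
    obtain ⟨c, hc, -, hcb, hfc⟩ := ivt (x - α) (by linarith) (by linarith) (hab (by linarith))
    exact ⟨c, hc, hcb, α, hα, by linarith, by linarith⟩

/-- At an intermediate parameter `b`, the slack of the left endpoint still meets the lower bound and
that of the right endpoint the upper bound. If neither meets both, a slack between them hits `x`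
exactly. -/
theorem convex_setOf_exists_mem_Icc {T S : Set ℝ} (hT : Convex ℝ T) (hS : Convex ℝ S)
    {f : ℝ → ℝ} (hmono : MonotoneOn f T) (p x : ℝ) :
    Convex ℝ {c | c ∈ T ∧ ∃ σ ∈ S, p ≤ σ + f c ∧ σ + f c ≤ x} := by
  refine Set.OrdConnected.convex ⟨?_⟩
  rintro a ⟨ha, α, hα, ha1, ha2⟩ c ⟨hc, γ, hγ, hc1, hc2⟩ b hb
  have hbT := hT.ordConnected.out ha hc hb
  have h1 := hmono ha hbT hb.1
  have h2 := hmono hbT hc hb.2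
  refine ⟨hbT, ?_⟩
  by_cases h : α + f b ≤ x
  · exact ⟨α, hα, by linarith, h⟩
  by_cases h' : p ≤ γ + f b
  · exact ⟨γ, hγ, h', by linarith⟩
  exact ⟨x - f b, hS.ordConnected.out hγ hα ⟨by linarith, by linarith⟩, by linarith, by linarith⟩

theorem forestOutput_insert_self {ι : Type*} [DecidableEq ι] {par : ι → Option ι}
    {up down : ι → ℝ → ℝ} {s : Finset ι} {j : ι} (hj : ∀ c ∈ insert j s, par c ≠ some j)
    (t : ι → ℝ) : forestOutput par up down (insert j s) t j = up j (t j) := by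
  rw [forestOutput, Finset.sum_eq_zero, add_zero]
  exact fun c hc => if_neg (hj c hc)

theorem forestOutput_insert {ι : Type*} [DecidableEq ι] {par : ι → Option ι}
    {up down : ι → ℝ → ℝ} {s : Finset ι} {j : ι} (hj : j ∉ s) (t : ι → ℝ) (v : ι) :
    forestOutput par up down (insert j s) t v =
      (if par j = some v then down j (t j) else 0) + forestOutput par up down s t v := by
  rw [forestOutput, forestOutput, Finset.sum_insert hj]
  ring

-- The slack `S v` collects the flows from children already eliminated. A vertex `j` of maximal rank
-- is a leaf, so its constraint involves only its own parameter and slack. Its admissible parameters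
-- form an interval `A`, and `down j '' A` is added to the slack of the parent. As `A` contains some
-- `c ≥ a j` and some `d ≤ b j`, and `down j` is antitone, both one-sided hypotheses survive.
open Pointwise in
theorem exists_add_forestOutput_mem_Icc {ι : Type*} [DecidableEq ι] {par : ι → Option ι}
    {rank : ι → ℕ} (hrank : ∀ v w, par v = some w → rank w < rank v)
    {T : ι → Set ℝ} {up down : ι → ℝ → ℝ} (hT : ∀ v, Convex ℝ (T v))
    (hup : ∀ v, ContinuousOn (up v) (T v)) (hdown : ∀ v, ContinuousOn (down v) (T v))
    (hmono : ∀ v, MonotoneOn (up v) (T v)) (hanti : ∀ v, AntitoneOn (down v) (T v))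
    {a b p x : ι → ℝ} (ha : ∀ v, a v ∈ T v) (hb : ∀ v, b v ∈ T v) (hpx : p ≤ x) (s : Finset ι) :
    ∀ {S : ι → Set ℝ} {α β : ι → ℝ}, (∀ v, Convex ℝ (S v)) → (∀ v, α v ∈ S v) →
      (∀ v, β v ∈ S v) →
      (∀ v ∈ s, α v + forestOutput par up down s a v ≤ x v) →
      (∀ v ∈ s, p v ≤ β v + forestOutput par up down s b v) →
      ∃ t σ : ι → ℝ, (∀ v, t v ∈ T v) ∧ (∀ v, σ v ∈ S v) ∧
        ∀ v ∈ s, p v ≤ σ v + forestOutput par up down s t v ∧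
          σ v + forestOutput par up down s t v ≤ x v := by
  induction s using Finset.induction_on_max_value rank with
  | empty => exact fun _ hα _ _ _ => ⟨a, _, ha, hα, by simp⟩
  | insert j s hjs hmax ih =>
    intro S α β hS hα hβ h₁ h₂
    have hjself : par j ≠ some j := fun h => (hrank j j h).false
    have hj : ∀ c ∈ insert j s, par c ≠ some j := by
      intro c hc h
      have := hrank c j h
      rcases Finset.mem_insert.1 hc with rfl | hc
      · exact this.false
      · exact (hmax c hc).not_gt this
    have h₁j := h₁ j (Finset.mem_insert_self j s)
    have h₂j := h₂ j (Finset.mem_insert_self j s)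
    rw [forestOutput_insert_self hj] at h₁j h₂j
    obtain ⟨⟨c, hc, hac, hcA⟩, d, hd, hdb, hdA⟩ := exists_mem_Icc_of_monotoneOn (hT j) (hS j)
      (hup j) (hpx j) (hα j) (hβ j) (ha j) (hb j) (hmono j) h₁j h₂j
    set A : Set ℝ := {c | c ∈ T j ∧ ∃ σ ∈ S j, p j ≤ σ + up j c ∧ σ + up j c ≤ x j}
    have hAconv : Convex ℝ A := convex_setOf_exists_mem_Icc (hT j) (hS j) (hmono j) _ _
    have hdA' : Convex ℝ (down j '' A) := by
      rw [Real.convex_iff_isPreconnected] at hAconv ⊢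
      exact hAconv.image _ ((hdown j).mono fun y hy => hy.1)
    obtain ⟨t, σ, ht, hσ, htσ⟩ := @ih
      (fun v => if par j = some v then S v + down j '' A else S v)
      (fun v => α v + if par j = some v then down j c else 0)
      (fun v => β v + if par j = some v then down j d else 0)
      (by
        intro v
        split_ifs
        exacts [(hS v).add hdA', hS v])
      (by
        intro v
        split_ifs
        · exact Set.add_mem_add (hα v) ⟨c, ⟨hc, hcA⟩, rfl⟩
        · simpa using hα v)
      (by
        intro v
        split_ifs
        · exact Set.add_mem_add (hβ v) ⟨d, ⟨hd, hdA⟩, rfl⟩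
        · simpa using hβ v)
      (by
        intro v hv
        have h := h₁ v (Finset.mem_insert_of_mem hv)
        rw [forestOutput_insert hjs] at h
        have := hanti j (ha j) hc hac
        split_ifs at h ⊢ <;> linarith)
      (by
        intro v hv
        have h := h₂ v (Finset.mem_insert_of_mem hv)
        rw [forestOutput_insert hjs] at h
        have := hanti j hd (hb j) hdb
        split_ifs at h ⊢ <;> linarith)
    -- Split the parent's enlarged slack into its original part and a flow `down j e`, which fixes
    -- the parameter at `j`; at a root any element of `A` serves.
    obtain ⟨e, heA, τ, hτ⟩ : ∃ e ∈ A, ∃ τ : ι → ℝ, (∀ v, τ v ∈ S v) ∧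
        ∀ v, σ v = τ v + if par j = some v then down j e else 0 := by
      cases hm : par j with
      | none => exact ⟨c, ⟨hc, hcA⟩, σ, fun v => by simpa [hm] using hσ v, fun v => by simp⟩
      | some m =>
        have hσm := hσ m
        simp only [hm, if_true] at hσm
        obtain ⟨y, hy, z, ⟨e, he, rfl⟩, hyz⟩ := hσm
        refine ⟨e, he, Function.update σ m y, fun v => ?_, fun v => ?_⟩
        · by_cases hv : v = m
          · subst hv; simpa using hy
          · have := hσ v
            rw [if_neg (by simpa [hm] using Ne.symm hv)] at this
            simpa [hv] using this
        · by_cases hv : v = m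
          · subst hv; simpa using hyz.symm
          · simp [hv, Ne.symm hv]
    obtain ⟨heT, ε, hεS, hε⟩ := heA
    refine ⟨Function.update t j e, Function.update τ j ε, fun v => ?_, fun v => ?_, ?_⟩
    · by_cases hv : v = j
      · subst hv; simpa using heT
      · simpa [hv] using ht v
    · by_cases hv : v = j
      · subst hv; simpa using hεS
      · simpa [hv] using hτ.1 v
    intro v hv
    by_cases hvj : v = j
    · subst hvj
      rw [forestOutput_insert_self hj]
      simpa using hε
    have hvs := (Finset.mem_insert.1 hv).resolve_left hvj
    have hout : forestOutput par up down s (Function.update t j e) v =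
        forestOutput par up down s t v := by
      rw [forestOutput, forestOutput, Function.update_of_ne hvj]
      congr 1
      refine Finset.sum_congr rfl fun c hc => ?_
      rw [Function.update_of_ne (ne_of_mem_of_not_mem hc hjs)]
    have h := htσ v hvs
    rw [hτ.2 v] at h
    rw [forestOutput_insert hjs, hout, Function.update_self, Function.update_of_ne hvj, ← add_assoc]
    exact h

/-! ### Sums over darts and the geometry of a circular arc -/

theorem SimpleGraph.sum_dart_ite {V : Type*} [Fintype V] [DecidableEq V] {G : SimpleGraph V}
    [DecidableRel G.Adj] (f : G.Dart → ℝ) (i : V) :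
    ∑ d : G.Dart, (if i = d.fst then 1 else 0) * f d =
      ∑ k, if h : G.Adj i k then f ⟨(i, k), h⟩ else 0 := by
  have h₁ : ∀ k, (if h : G.Adj i k then f ⟨(i, k), h⟩ else 0) =
      ∑ d : G.Dart, if i = d.fst ∧ d.snd = k then f d else 0 := by
    intro k
    split_ifs with h
    · rw [Finset.sum_eq_single ⟨(i, k), h⟩]
      · simp
      · rintro d - hd
        exact if_neg fun h' => hd (SimpleGraph.Dart.ext _ _ (Prod.ext h'.1.symm h'.2))
      · simp
    · refine (Finset.sum_eq_zero fun d _ => if_neg ?_).symm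
      rintro ⟨rfl, rfl⟩
      exact h d.adj
  rw [Finset.sum_congr rfl fun k _ => h₁ k, Finset.sum_comm]
  refine Finset.sum_congr rfl fun d _ => ?_
  by_cases h : i = d.fst <;> simp [h]

/-- A chord lies in the unit disc, so moving horizontally to the right half of the circle can only
increase the cosine. -/
theorem exists_sin_eq_le_cos {T : Set ℝ} (hT : Convex ℝ T)
    (hsub : T ⊆ Set.Icc (-(Real.pi / 2)) (Real.pi / 2)) {s t a b : ℝ} (hs : s ∈ T) (ht : t ∈ T)
    (ha : 0 ≤ a) (hb : 0 ≤ b) (hab : a + b = 1) :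
    ∃ θ ∈ T, Real.sin θ = a * Real.sin s + b * Real.sin t ∧
      a * Real.cos s + b * Real.cos t ≤ Real.cos θ := by
  have hmem : a * Real.sin s + b * Real.sin t ∈ Set.uIcc (Real.sin s) (Real.sin t) := by
    rw [← segment_eq_uIcc]
    exact ⟨a, b, ha, hb, hab, rfl⟩
  obtain ⟨θ, hθ, hsin⟩ := intermediate_value_uIcc Real.continuous_sin.continuousOn hmem
  have hθT : θ ∈ T := hT.ordConnected.uIcc_subset hs ht hθ
  refine ⟨θ, hθT, hsin, ?_⟩
  refine le_of_sq_le_sq ?_ (Real.cos_nonneg_of_mem_Icc (hsub hθT))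
  have h₁ := Real.sin_sq_add_cos_sq θ
  rw [hsin] at h₁
  have h₂ := Real.cos_le_one (s - t)
  rw [Real.cos_sub] at h₂
  have h₃ := Real.sin_sq_add_cos_sq s
  have h₄ := Real.sin_sq_add_cos_sq t
  obtain rfl : b = 1 - a := by linarith
  linear_combination 2 * mul_le_mul_of_nonneg_left h₂ (mul_nonneg ha hb) + a ^ 2 * h₃ +
    (1 - a) ^ 2 * h₄ - h₁

/-! ### Monotonicity of the line flows -/

namespace TreeNetwork

variable {n : ℕ}

theorem criticalAngle_le (N : TreeNetwork n) (i k : Fin n) :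
    N.criticalAngle i k ≤ Real.pi / 2 := by
  unfold criticalAngle
  split_ifs
  exacts [le_rfl, (Real.arctan_lt_pi_div_two _).le]

theorem criticalAngle_symm (N : TreeNetwork n) {i k : Fin n} (h : N.graph.Adj i k) :
    N.criticalAngle k i = N.criticalAngle i k := by
  rw [criticalAngle, criticalAngle, N.g_symm i k h, N.b_symm i k h]

theorem continuous_flow (N : TreeNetwork n) (i k : Fin n) : Continuous (N.flow i k) := by
  unfold flow
  fun_prop

theorem flow_deriv_nonneg (N : TreeNetwork n) {i k : Fin n} (h : N.graph.Adj i k) {θ : ℝ}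
    (h₁ : -N.criticalAngle i k < θ) (h₂ : θ < N.criticalAngle i k) :
    0 ≤ N.b i k * Real.cos θ + N.g i k * Real.sin θ := by
  have hc := N.criticalAngle_le i k
  have hlow : -(Real.pi / 2) < θ := by linarith
  have hhigh : θ < Real.pi / 2 := by linarith
  have hcos : 0 < Real.cos θ := Real.cos_pos_of_mem_Ioo ⟨hlow, hhigh⟩
  rcases (N.g_nonneg i k h).eq_or_lt with hg | hg
  · rw [← hg, zero_mul, add_zero]
    exact mul_nonneg (N.b_nonneg i k h) hcos.le
  · rw [criticalAngle, if_neg hg.ne', ← Real.arctan_neg] at h₁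
    have htan : -(N.b i k / N.g i k) < Real.tan θ := by
      rw [← Real.arctan_lt_arctan_iff, Real.arctan_tan hlow hhigh]
      exact h₁
    rw [Real.tan_eq_sin_div_cos, lt_div_iff₀ hcos] at htan
    have := mul_lt_mul_of_pos_left htan hg
    have e : N.g i k * (-(N.b i k / N.g i k) * Real.cos θ) = -(N.b i k * Real.cos θ) := by
      field_simp
    linarith

theorem flow_monotoneOn (N : TreeNetwork n) {i k : Fin n} (h : N.graph.Adj i k) :
    MonotoneOn (N.flow i k) (Set.Ioo (-N.criticalAngle i k) (N.criticalAngle i k)) := by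
  have hd : ∀ θ, HasDerivAt (N.flow i k)
      (N.V i * N.V k * (N.b i k * Real.cos θ + N.g i k * Real.sin θ)) θ := by
    intro θ
    have := (((Real.hasDerivAt_sin θ).const_mul (N.V i * N.V k * N.b i k)).const_add
      (N.V i ^ 2 * N.g i k)).sub ((Real.hasDerivAt_cos θ).const_mul (N.V i * N.V k * N.g i k))
    exact this.congr_deriv (by ring)
  refine monotoneOn_of_deriv_nonneg (convex_Ioo _ _) (N.continuous_flow i k).continuousOn
    (fun θ _ => (hd θ).differentiableAt.differentiableWithinAt) fun θ hθ => ?_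
  rw [interior_Ioo] at hθ
  rw [(hd θ).deriv]
  exact mul_nonneg (mul_nonneg (N.V_nonneg i) (N.V_nonneg k)) (N.flow_deriv_nonneg h hθ.1 hθ.2)

/-! ### The network with one angle per non-root bus -/

/-- The flow from `v` to its parent, at angle difference `θ` between `v` and the parent. -/
noncomputable def upFlow (N : TreeNetwork n) (par : Fin n → Option (Fin n)) (v : Fin n) (θ : ℝ) :
    ℝ :=
  (par v).elim 0 fun m => N.flow v m θ

/-- The flow from the parent of `v` to `v`, at angle difference `θ` between `v` and the parent. -/
noncomputable def downFlow (N : TreeNetwork n) (par : Fin n → Option (Fin n)) (v : Fin n)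
    (θ : ℝ) : ℝ :=
  (par v).elim 0 fun m => N.flow m v (-θ)

/-- The admissible angle differences between `v` and its parent (`{0}` for a root). -/
def angleRange (N : TreeNetwork n) (par : Fin n → Option (Fin n)) (v : Fin n) : Set ℝ :=
  (par v).elim {0} fun m => Set.Icc (N.θmin v m) (N.θmax v m)

section Rooted

variable (N : TreeNetwork n) {par : Fin n → Option (Fin n)}

theorem convex_angleRange (v : Fin n) : Convex ℝ (N.angleRange par v) := by
  unfold angleRange
  cases par v
  exacts [convex_singleton 0, convex_Icc _ _]

theorem continuous_upFlow (v : Fin n) : Continuous (N.upFlow par v) := by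
  unfold upFlow
  cases par v
  exacts [continuous_const, N.continuous_flow _ _]

theorem continuous_downFlow (v : Fin n) : Continuous (N.downFlow par v) := by
  unfold downFlow
  cases par v
  exacts [continuous_const, (N.continuous_flow _ _).comp continuous_neg]

theorem angleRange_subset (hangle : N.AngleAssumption)
    (hadj : ∀ v w, par v = some w → N.graph.Adj v w) (v : Fin n) :
    N.angleRange par v ⊆ Set.Icc (-(Real.pi / 2)) (Real.pi / 2) := by
  unfold angleRange
  cases hm : par v with
  | none =>
    have := Real.pi_pos
    rintro _ rfl
    exact ⟨by linarith, by linarith⟩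
  | some m =>
    have h := hangle v m (hadj v m hm)
    have := N.criticalAngle_le v m
    exact Set.Icc_subset_Icc (by linarith) (by linarith)

theorem upFlow_monotoneOn (hangle : N.AngleAssumption)
    (hadj : ∀ v w, par v = some w → N.graph.Adj v w) (v : Fin n) :
    MonotoneOn (N.upFlow par v) (N.angleRange par v) := by
  unfold angleRange upFlow
  cases hm : par v with
  | none => exact monotoneOn_const
  | some m =>
    have h := hangle v m (hadj v m hm)
    exact (N.flow_monotoneOn (hadj v m hm)).mono (Set.Icc_subset_Ioo h.1 h.2.2)

theorem downFlow_antitoneOn (hangle : N.AngleAssumption)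
    (hadj : ∀ v w, par v = some w → N.graph.Adj v w) (v : Fin n) :
    AntitoneOn (N.downFlow par v) (N.angleRange par v) := by
  unfold angleRange downFlow
  cases hm : par v with
  | none => exact antitoneOn_const
  | some m =>
    have h := hangle v m (hadj v m hm)
    have hs := N.criticalAngle_symm (hadj v m hm)
    intro s hs' t ht hst
    refine N.flow_monotoneOn (hadj v m hm).symm ?_ ?_ (neg_le_neg hst)
    · rw [hs]; exact ⟨by linarith [ht.2], by linarith [ht.1]⟩
    · rw [hs]; exact ⟨by linarith [hs'.2], by linarith [hs'.1]⟩

/-- Both flows are affine in sine and cosine, with the same nonpositive coefficient on the cosine.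
-/
theorem upFlow_le_and_downFlow_le (hadj : ∀ v w, par v = some w → N.graph.Adj v w) (v : Fin n)
    {s t θ a b : ℝ} (hab : a + b = 1) (hsin : Real.sin θ = a * Real.sin s + b * Real.sin t)
    (hcos : a * Real.cos s + b * Real.cos t ≤ Real.cos θ) :
    N.upFlow par v θ ≤ a * N.upFlow par v s + b * N.upFlow par v t ∧
      N.downFlow par v θ ≤ a * N.downFlow par v s + b * N.downFlow par v t := by
  unfold upFlow downFlow
  cases hm : par v with
  | none => simp
  | some m =>
    have h := hadj v m hm
    have := mul_le_mul_of_nonneg_left hcos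
      (mul_nonneg (mul_nonneg (N.V_nonneg v) (N.V_nonneg m)) (N.g_nonneg v m h))
    obtain rfl : b = 1 - a := by linarith
    simp only [Option.elim_some, flow, N.g_symm v m h, N.b_symm v m h, Real.sin_neg,
      Real.cos_neg, hsin]
    constructor <;> linarith

theorem injectionMatrix_mulVec_eq [Fintype N.graph.Dart]
    (hpar : ∀ v w, N.graph.Adj v w ↔ par v = some w ∨ par w = some v)
    (hasymm : ∀ v w, par v = some w → par w ≠ some v) {f : N.graph.Dart → ℝ} {t : Fin n → ℝ}
    (hf : ∀ d : N.graph.Dart, par d.fst = some d.snd →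
      f d = N.upFlow par d.fst (t d.fst) ∧ f d.symm = N.downFlow par d.fst (t d.fst)) :
    N.injectionMatrix.mulVec f =
      forestOutput par (N.upFlow par) (N.downFlow par) Finset.univ t := by
  classical
  funext i
  have h₁ : N.injectionMatrix.mulVec f i =
      ∑ d : N.graph.Dart, (if i = d.fst then 1 else 0) * f d := rfl
  have h₂ := SimpleGraph.sum_dart_ite f i
  have h₃ : ∀ k, (if h : N.graph.Adj i k then f ⟨(i, k), h⟩ else 0) =
      (if par i = some k then N.upFlow par i (t i) else 0) +
        if par k = some i then N.downFlow par k (t k) else 0 := by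
    intro k
    by_cases hik : par i = some k
    · have h := (hpar i k).2 (Or.inl hik)
      rw [dif_pos h, if_pos hik, if_neg (hasymm i k hik), add_zero]
      exact (hf ⟨(i, k), h⟩ hik).1
    · rw [if_neg hik, zero_add]
      by_cases hki : par k = some i
      · have h := (hpar i k).2 (Or.inr hki)
        rw [dif_pos h, if_pos hki]
        exact (hf ⟨(k, i), h.symm⟩ hki).2
      · rw [if_neg hki, dif_neg fun h => ((hpar i k).1 h).elim hik hki]
  have h₄ : (∑ k, if par i = some k then N.upFlow par i (t i) else 0) = N.upFlow par i (t i) := by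
    cases hm : par i with
    | none => simp [upFlow, hm]
    | some m => simp
  rw [h₁, forestOutput]
  refine Eq.trans ?_ (h₂.trans ?_)
  -- The two sums use possibly different `Fintype` instances on darts.
  · exact Finset.sum_congr (by ext; simp) fun _ _ => rfl
  · rw [Finset.sum_congr rfl fun k _ => h₃ k, Finset.sum_add_distrib, h₄]

open Classical in
theorem angleInjectionRegion_eq
    (hpar : ∀ v w, N.graph.Adj v w ↔ par v = some w ∨ par w = some v)
    (hasymm : ∀ v w, par v = some w → par w ≠ some v) :
    N.angleInjectionRegion =
      {x | ∃ t : Fin n → ℝ, (∀ v, t v ∈ N.angleRange par v) ∧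
        forestOutput par (N.upFlow par) (N.downFlow par) Finset.univ t = x} := by
  ext x
  constructor
  · rintro ⟨f, hf, rfl⟩
    choose θ hθ hfθ using hf
    have hadj : ∀ v m, par v = some m → N.graph.Adj v m := fun v m h => (hpar v m).2 (Or.inl h)
    have key : ∀ v, ∃ t ∈ N.angleRange par v, ∀ m (h : par v = some m),
        t = θ ⟨(v, m), hadj v m h⟩ := by
      intro v
      unfold angleRange
      obtain hm | ⟨m, hm⟩ := (par v).eq_none_or_eq_some
      · exact ⟨0, by simp [hm], by simp [hm]⟩
      · refine ⟨θ ⟨(v, m), hadj v m hm⟩, ?_, ?_⟩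
        · simpa only [hm, Option.elim_some] using hθ ⟨(v, m), hadj v m hm⟩
        · intro m' h
          obtain rfl := Option.some_inj.1 (hm.symm.trans h)
          rfl
    choose t ht htθ using key
    refine ⟨t, ht, (N.injectionMatrix_mulVec_eq hpar hasymm ?_).symm⟩
    intro d hd
    have h := hfθ d
    rw [Prod.mk.injEq] at h
    simpa [upFlow, downFlow, hd, htθ _ _ hd] using h
  · rintro ⟨t, ht, rfl⟩
    refine ⟨fun d => if par d.fst = some d.snd then N.upFlow par d.fst (t d.fst)
      else N.downFlow par d.snd (t d.snd), ?_, N.injectionMatrix_mulVec_eq hpar hasymm ?_⟩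
    · intro d
      rcases (hpar _ _).1 d.adj with hd | hd
      · have h := ht d.fst
        rw [angleRange, hd] at h
        refine ⟨t d.fst, h, ?_⟩
        simp [hd, hasymm _ _ hd, upFlow, downFlow]
      · have h := ht d.snd
        rw [angleRange, hd] at h
        have h₁ := N.θmax_swap _ _ d.adj
        have h₂ := N.θmax_swap _ _ d.adj.symm
        refine ⟨-t d.snd, ⟨by linarith [h.2], by linarith [h.1]⟩, ?_⟩
        simp [hd, hasymm _ _ hd, upFlow, downFlow]
    · intro d hd
      simp [hd, hasymm _ _ hd]

/-- The upward closure of the region is convex: the lines can be treated independently, and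
injections are sums of flows. -/
theorem convexHull_angleInjectionRegion_subset (hangle : N.AngleAssumption)
    (hpar : ∀ v w, N.graph.Adj v w ↔ par v = some w ∨ par w = some v)
    (hasymm : ∀ v w, par v = some w → par w ≠ some v) :
    convexHull ℝ N.angleInjectionRegion ⊆
      {x | ∃ t : Fin n → ℝ, (∀ v, t v ∈ N.angleRange par v) ∧
        forestOutput par (N.upFlow par) (N.downFlow par) Finset.univ t ≤ x} := by
  have hadj : ∀ v m, par v = some m → N.graph.Adj v m := fun v m h => (hpar v m).2 (Or.inl h)
  refine convexHull_min ?_ ?_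
  · rw [N.angleInjectionRegion_eq hpar hasymm]
    rintro x ⟨t, ht, h⟩
    exact ⟨t, ht, h.le⟩
  · rintro x ⟨s, hs, hsx⟩ y ⟨t, ht, hty⟩ a b ha hb hab
    choose θ hθ hsin hcos using fun v => exists_sin_eq_le_cos (N.convex_angleRange (par := par) v)
      (N.angleRange_subset hangle hadj v) (hs v) (ht v) ha hb hab
    refine ⟨θ, hθ, le_trans (fun v => ?_)
      (add_le_add (smul_le_smul_of_nonneg_left hsx ha) (smul_le_smul_of_nonneg_left hty hb))⟩
    have key := fun v => N.upFlow_le_and_downFlow_le hadj v hab (hsin v) (hcos v)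
    have hsum : (∑ c, if par c = some v then N.downFlow par c (θ c) else 0) ≤
        a * (∑ c, if par c = some v then N.downFlow par c (s c) else 0) +
          b * ∑ c, if par c = some v then N.downFlow par c (t c) else 0 := by
      rw [Finset.mul_sum, Finset.mul_sum, ← Finset.sum_add_distrib]
      refine Finset.sum_le_sum fun c _ => ?_
      split_ifs
      · exact (key c).2
      · simp
    have := (key v).1
    simp only [forestOutput, Pi.add_apply, Pi.smul_apply, smul_eq_mul]
    linarith

end Rooted

/-! ### Domination and Pareto fronts -/

theorem exists_mem_injectionRegion_le (N : TreeNetwork n) {pmin pmax : Fin n → ℝ}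
    (hangle : N.AngleAssumption) (hne : (N.injectionRegion pmin pmax).Nonempty) {x : Fin n → ℝ}
    (hx : x ∈ convexHull ℝ N.angleInjectionRegion ∩ powerBox pmin pmax) :
    ∃ y ∈ N.injectionRegion pmin pmax, y ≤ x := by
  obtain ⟨par, rank, hrank, hpar⟩ := N.isTree.exists_parent
  have hasymm : ∀ v w, par v = some w → par w ≠ some v := fun v w h h' =>
    (hrank v w h).not_gt (hrank w v h')
  have hadj : ∀ v m, par v = some m → N.graph.Adj v m := fun v m h => (hpar v m).2 (Or.inl h)
  have hregion := N.angleInjectionRegion_eq hpar hasymm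
  obtain ⟨a, ha, hax⟩ := N.convexHull_angleInjectionRegion_subset hangle hpar hasymm hx.1
  obtain ⟨z, hz, hzbox⟩ := hne
  rw [hregion] at hz
  obtain ⟨b, hb, rfl⟩ := hz
  -- No child has been eliminated at the start, so every slack set is `{0}`.
  obtain ⟨t, σ, ht, hσ, h⟩ := exists_add_forestOutput_mem_Icc hrank N.convex_angleRange
    (fun v => (N.continuous_upFlow v).continuousOn)
    (fun v => (N.continuous_downFlow v).continuousOn)
    (N.upFlow_monotoneOn hangle hadj) (N.downFlow_antitoneOn hangle hadj) ha hb hx.2.1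
    Finset.univ (S := fun _ => {0}) (α := 0) (β := 0) (fun _ => convex_singleton 0)
    (fun _ => rfl) (fun _ => rfl) (fun v _ => by simpa using hax v)
    (fun v _ => by simpa using hzbox.1 v)
  have hσ' : ∀ v, σ v = 0 := hσ
  simp only [hσ', zero_add, Finset.mem_univ, true_implies] at h
  have hle : forestOutput par (N.upFlow par) (N.downFlow par) Finset.univ t ≤ x :=
    fun v => (h v).2
  refine ⟨_, ⟨?_, fun v => (h v).1, hle.trans hx.2.2⟩, hle⟩
  rw [hregion]
  exact ⟨t, ht, rfl⟩

end TreeNetwork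

theorem paretoFront_eq_of_forall_exists_le {ι : Type*} {A B : Set (ι → ℝ)} (hAB : A ⊆ B)
    (h : ∀ x ∈ B, ∃ y ∈ A, y ≤ x) : paretoFront A = paretoFront B := by
  ext x
  constructor
  · rintro ⟨hx, hmin⟩
    refine ⟨hAB hx, ?_⟩
    rintro ⟨y, hy, hyx, i, hi⟩
    obtain ⟨z, hz, hzy⟩ := h y hy
    exact hmin ⟨z, hz, hzy.trans hyx, i, (hzy i).trans_lt hi⟩
  · rintro ⟨hx, hmin⟩
    obtain ⟨y, hy, hyx⟩ := h x hx
    have hxy : y = x := by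
      by_contra hne
      obtain ⟨-, i, hi⟩ := Pi.lt_def.1 (lt_of_le_of_ne hyx hne)
      exact hmin ⟨y, hAB hy, hyx, i, hi⟩
    exact ⟨hxy ▸ hy, fun ⟨z, hz, hzx⟩ => hmin ⟨z, hAB hz, hzx⟩⟩

theorem mainTheorem2 {n : ℕ} (N : TreeNetwork n) (pmin pmax : Fin n → ℝ)
    (hangle : N.AngleAssumption) (hne : (N.injectionRegion pmin pmax).Nonempty) :
    paretoFront (N.injectionRegion pmin pmax) =
      paretoFront
        (convexHull ℝ N.angleInjectionRegion ∩ TreeNetwork.powerBox pmin pmax) :=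
  paretoFront_eq_of_forall_exists_le
    (Set.inter_subset_inter_left _ (subset_convexHull ℝ _))
    fun _ hx => N.exists_mem_injectionRegion_le hangle hne hx
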